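/- Let $D\subset\mathbb{R}^d$ be a bounded domain, let $\lambda:\overline D\to(0,\infty)$ be continuous, and put $\bar\lambda:=\int_{\overline D}\lambda(x)\,dx$. Let $\mathcal S=\mathcal S(\overline D)$ be the set of lower semicontinuous functions $\overline D\to\mathbb{R}\cup\{+\infty\}$ with the topology of $\Gamma$-convergence, that is, the topology generated by the sets $\{f:\inf_U f<t\}$ ($U\subset\overline D$ relatively open, $t\in\mathbb{R}$) and $\{f:\inf_K f>t\}$ ($K\subset\overline D$ compact, $t\in\mathbb{R}$), and with its Borel $\sigma$-algebra. Let $\mathcal P(\mathcal S)$ be the set of Borel probability measures on $\mathcal S$ with the topology of weak convergence. Then there is exactly one law in $\mathcal P(\mathcal S)$ of a random element $W_\lambda$ of $\mathcal S$ such that 1. for every closed $C\subset\overline D$, $\min_C W_\lambda$ is exponentially distributed with rate $\lambda_C:=\int_C\lambda(x)\,dx$ (if $\lambda_C=0$ this means $\min_C W_\lambda=+\infty$ almost surely; $\min_\emptyset W_\lambda=+\infty$); 2. for all pairwise disjoint closed sets $C_1,\dots,C_k\subset\overline D$, the random variables $\min_{C_1}W_\lambda,\dots,\min_{C_k}W_\lambda$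 are independent. Moreover, let $x_1,x_2,\dots$ be i.i.d. points of $\overline D$ with law $\frac{\lambda(x)}{\bar\lambda}\,dx$, let $\xi_1,\xi_2,\dots$ be i.i.d. exponential random variables with rate $\bar\lambda$, and let the sequences $(x_i)$ and $(\xi_j)$ be independent of each other. Define $$W_n(x)=\min\Big\{\sum_{j=1}^{i}\xi_j \;:\; 1\le i\le n,\ x_i=x\Big\},\qquad \min\emptyset:=+\infty,$$ that is, $W_n(x_i)=\xi_1+\dots+\xi_i$ for $i\le n$ if the points $x_i$ are distinct, and $W_n=+\infty$ elsewhere. Then each $W_n$ is a random element of $\mathcal S$, and $W_n$ converges weakly in $\mathcal P(\mathcal S)$ to $W_\lambda$ as $n\to\infty$. -/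

import Mathlib

open MeasureTheory ProbabilityTheory Filter Topology

/-- The space `S(X)` of lower semicontinuous functions on `X` with values in `ℝ ∪ {+∞}`. -/
@[ext]
structure LscFun (X : Type*) [TopologicalSpace X] where
  toFun : X → EReal
  lsc : LowerSemicontinuous toFun
  ne_bot : ∀ x, toFun x ≠ ⊥

namespace LscFun

/-- The infimum of `f` over `C`. If `X` is compact and `C` is closed and nonempty, it is attained;
over the empty set it is `+∞`. -/
noncomputable def infOn {X : Type*} [TopologicalSpace X] (C : Set X) (f : LscFun X) : EReal :=
  ⨅ x ∈ C, f.toFun x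

/-- The topology `σ⁺`, generated by the sets `{f | inf_U f < t}` with `U` open and `t` real. -/
@[reducible] def sigmaPlus (X : Type*) [TopologicalSpace X] : TopologicalSpace (LscFun X) :=
  TopologicalSpace.generateFrom
    {A | ∃ U : Set X, IsOpen U ∧ ∃ t : ℝ, A = {f | infOn U f < (t : EReal)}}

/-- The topology `σ⁻`, generated by the sets `{f | inf_K f > t}` with `K` compact and `t` real. -/
@[reducible] def sigmaMinus (X : Type*) [TopologicalSpace X] : TopologicalSpace (LscFun X) :=
  TopologicalSpace.generateFrom
    {A | ∃ K : Set X, IsCompact K ∧ ∃ t : ℝ, A = {f | (t : EReal) < infOn K f}}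

/-- The topology `σ` of `Γ`-convergence: the smallest topology that contains `σ⁺` and `σ⁻`
(in the order used here, `⊓` is the topology generated by the union of the two). -/
instance (X : Type*) [TopologicalSpace X] : TopologicalSpace (LscFun X) :=
  sigmaPlus X ⊓ sigmaMinus X

instance (X : Type*) [TopologicalSpace X] : MeasurableSpace (LscFun X) :=
  borel (LscFun X)

instance (X : Type*) [TopologicalSpace X] : BorelSpace (LscFun X) := ⟨rfl⟩

end LscFun

/-- Lebesgue measure on the closure of `D`, as a measure on the subtype. -/
noncomputable def closureVolume {d : ℕ} (D : Set (EuclideanSpace ℝ (Fin d))) :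
    Measure (closure D) :=
  (volume : Measure (EuclideanSpace ℝ (Fin d))).comap Subtype.val

/-- The exponential distribution of rate `r ≥ 0` on `[0, +∞]`. For `r = 0` it is the point mass
at `+∞`. -/
noncomputable def extExpMeasure (r : ℝ) : Measure EReal :=
  if r = 0 then Measure.dirac ⊤ else (expMeasure r).map Real.toEReal

/-- `ν` is the law of the random lower semicontinuous function `W_λ` (`dx` being `vol`): the minimum over a closed
set `C` is exponential of rate `∫_C λ`, and the minima over finitely many pairwise disjoint closed
sets are independent. -/
structure IsExtremalLaw {X : Type*} [TopologicalSpace X] [MeasurableSpace X] (vol : Measure X)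
    (lam : X → ℝ) (ν : Measure (LscFun X)) : Prop where
  hasLaw_infOn : ∀ C : Set X, IsClosed C →
    HasLaw (fun f : LscFun X => f.infOn C) (extExpMeasure (∫ x in C, lam x ∂vol)) ν
  iIndepFun_infOn : ∀ (k : ℕ) (C : Fin k → Set X), (∀ i, IsClosed (C i)) →
    Pairwise (fun i j => Disjoint (C i) (C j)) →
    iIndepFun (fun (i : Fin k) (f : LscFun X) => f.infOn (C i)) ν

/-- The function with value `ξ 0 + … + ξ i` at `x i` for `i < n` (the smallest of these values, if
several of the points coincide), and `+∞` at all other points. Indices start at `0`. -/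
noncomputable def arrivalFun {X : Type*} (x : ℕ → X) (ξ : ℕ → ℝ) (n : ℕ) (y : X) : EReal :=
  ⨅ i : ℕ, ⨅ _ : i < n ∧ x i = y, ((∑ j ∈ Finset.range (i + 1), ξ j : ℝ) : EReal)

theorem arrivalFun_eq_top {X : Type*} (x : ℕ → X) (ξ : ℕ → ℝ) (n : ℕ) (y : X)
    (hy : y ∉ x '' (Finset.range n : Set ℕ)) : arrivalFun x ξ n y = ⊤ := by
  refine iInf_eq_top.2 fun i => iInf_eq_top.2 fun hi => ?_
  exact absurd ⟨i, by simpa using hi.1, hi.2⟩ hy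

theorem arrivalFun_ne_bot {X : Type*} (x : ℕ → X) (ξ : ℕ → ℝ) (n : ℕ) (y : X) :
    arrivalFun x ξ n y ≠ ⊥ := by
  obtain ⟨m, hm⟩ : ∃ m : ℝ, ∀ i ∈ Finset.range n, m ≤ ∑ j ∈ Finset.range (i + 1), ξ j := by
    obtain ⟨m, hm⟩ := ((Finset.range n).image
      (fun i => ∑ j ∈ Finset.range (i + 1), ξ j)).bddBelow
    exact ⟨m, fun i hi => hm (Finset.mem_coe.2 (Finset.mem_image_of_mem _ hi))⟩
  have h : (m : EReal) ≤ arrivalFun x ξ n y :=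
    le_iInf fun i => le_iInf fun hi => EReal.coe_le_coe_iff.2 (hm i (Finset.mem_range.2 hi.1))
  exact ne_of_gt (lt_of_lt_of_le (EReal.bot_lt_coe m) h)

theorem lowerSemicontinuous_arrivalFun {X : Type*} [TopologicalSpace X] [T1Space X]
    (x : ℕ → X) (ξ : ℕ → ℝ) (n : ℕ) : LowerSemicontinuous (arrivalFun x ξ n) := by
  rw [lowerSemicontinuous_iff_isClosed_preimage]
  intro a
  by_cases ha : a = ⊤
  · simp [ha]
  · refine (((Finset.range n).finite_toSet.image x).subset ?_).isClosed
    intro y hy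
    by_contra h
    rw [Set.mem_preimage, arrivalFun_eq_top x ξ n y h, Set.mem_Iic, top_le_iff] at hy
    exact ha hy

/-- `arrivalFun` as an element of `S(X)`. -/
noncomputable def arrivalLsc {X : Type*} [TopologicalSpace X] [T1Space X]
    (x : ℕ → X) (ξ : ℕ → ℝ) (n : ℕ) : LscFun X where
  toFun := arrivalFun x ξ n
  lsc := lowerSemicontinuous_arrivalFun x ξ n
  ne_bot := arrivalFun_ne_bot x ξ n

/-! Uniqueness. The events "at least `t` on the closed set `C t`, for finitely many levels `t`" form
a π-system that generates the Borel σ-algebra (`borel_eq_generateFrom_minorizedSets`). At each point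
only the highest level binds, so the sets can be made disjoint; after exhausting them by closed
sets, conditions 1 and 2 determine the probability (`IsExtremalLaw.eq`).

Existence. With S_i = ξ_1 + … + ξ_i, the pairs (x_i, S_i) form a Poisson process of intensity λ(x)
dx dt. Their lower envelope W satisfies min_{C_k} W ≥ t_k for all k iff no pair lies strictly below
h = Σ max(t_k, 0) 1_{C_k}. This has probability exp(-∫ hλ), which factorizes over k
(`isExtremalLaw_map_arrivalLimit`). The void probability is found by a martingale argument: the
conditional probability of no pair below h, given the first n arrival times, has constant mean
(`lintegral_prod_mul_voidProb`), and S_n → ∞ identifies its limit (`measure_forall_le_sum`).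

Convergence. On the event S_n → ∞, W_n → W in the Γ-topology (`tendsto_arrivalLsc`), and almost sure
convergence implies weak convergence. -/

namespace LscFun

/-! ### The Γ-topology and a π-system of events -/

section Basic

variable {X : Type*} [TopologicalSpace X]

theorem le_infOn_iff {C : Set X} {f : LscFun X} {a : EReal} :
    a ≤ f.infOn C ↔ ∀ x ∈ C, a ≤ f.toFun x :=
  le_iInf₂_iff

theorem infOn_lt_iff {C : Set X} {f : LscFun X} {a : EReal} :
    f.infOn C < a ↔ ∃ x ∈ C, f.toFun x < a := by
  simp [infOn, iInf_lt_iff]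

theorem infOn_iUnion {ι : Sort*} (C : ι → Set X) (f : LscFun X) :
    f.infOn (⋃ i, C i) = ⨅ i, f.infOn (C i) :=
  iInf_iUnion C f.toFun

theorem isOpen_infOn_lt {U : Set X} (hU : IsOpen U) (t : ℝ) :
    IsOpen {f : LscFun X | f.infOn U < t} :=
  (inf_le_left : (inferInstance : TopologicalSpace (LscFun X)) ≤ sigmaPlus X) _
    (TopologicalSpace.isOpen_generateFrom_of_mem ⟨U, hU, t, rfl⟩)

theorem isOpen_lt_infOn {K : Set X} (hK : IsCompact K) (t : ℝ) :
    IsOpen {f : LscFun X | (t : EReal) < f.infOn K} :=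
  (inf_le_right : (inferInstance : TopologicalSpace (LscFun X)) ≤ sigmaMinus X) _
    (TopologicalSpace.isOpen_generateFrom_of_mem ⟨K, hK, t, rfl⟩)

theorem tendsto_nhds_of_infOn {ι : Type*} {l : Filter ι} {F : ι → LscFun X} {f : LscFun X}
    (hplus : ∀ U : Set X, IsOpen U → ∀ t : ℝ, f.infOn U < t → ∀ᶠ i in l, (F i).infOn U < t)
    (hminus : ∀ K : Set X, IsCompact K → ∀ t : ℝ, (t : EReal) < f.infOn K →
      ∀ᶠ i in l, (t : EReal) < (F i).infOn K) :
    Tendsto F l (𝓝 f) := by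
  have hinf : 𝓝 f = @nhds _ (sigmaPlus X) f ⊓ @nhds _ (sigmaMinus X) f :=
    @nhds_inf _ (sigmaPlus X) (sigmaMinus X) f
  rw [hinf, tendsto_inf]
  constructor
  · rw [TopologicalSpace.tendsto_nhds_generateFrom_iff]
    rintro _ ⟨U, hU, t, rfl⟩ h
    exact hplus U hU t h
  · rw [TopologicalSpace.tendsto_nhds_generateFrom_iff]
    rintro _ ⟨K, hK, t, rfl⟩ h
    exact hminus K hK t h

theorem coe_lt_infOn_iff {K : Set X} {f : LscFun X} {t : ℝ} (hK : IsCompact K) :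
    (t : EReal) < f.infOn K ↔ ∀ x ∈ K, (t : EReal) < f.toFun x := by
  refine ⟨fun h x hx => h.trans_le (le_infOn_iff.1 le_rfl x hx), fun h => ?_⟩
  rcases K.eq_empty_or_nonempty with rfl | hne
  · simp [infOn]
  · obtain ⟨a, ha, hmin⟩ := (f.lsc.lowerSemicontinuousOn K).exists_isMinOn hne hK
    exact (h a ha).trans_le (le_infOn_iff.2 fun x hx => hmin hx)

theorem measurableSet_le_infOn [CompactSpace X] {C : Set X} (hC : IsClosed C) (t : ℝ) :
    MeasurableSet {f : LscFun X | (t : EReal) ≤ f.infOn C} := by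
  have : {f : LscFun X | (t : EReal) ≤ f.infOn C} =
      ⋂ n : ℕ, {f | ((t - 1 / ((n : ℝ) + 1) : ℝ) : EReal) < f.infOn C} := by
    ext f
    simp only [Set.mem_ofPred_eq, Set.mem_iInter]
    refine ⟨fun h n => lt_of_lt_of_le (EReal.coe_lt_coe_iff.2 ?_) h, fun h => ?_⟩
    · have : (0 : ℝ) < 1 / ((n : ℝ) + 1) := by positivity
      linarith
    · have h1 : Tendsto (fun n : ℕ => ((t - 1 / ((n : ℝ) + 1) : ℝ) : EReal)) atTop
          (𝓝 ((t - 0 : ℝ) : EReal)) :=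
        (continuous_coe_real_ereal.tendsto _).comp
          (tendsto_const_nhds.sub tendsto_one_div_add_atTop_nhds_zero_nat)
      rw [sub_zero] at h1
      exact le_of_tendsto h1 (Eventually.of_forall fun n => (h n).le)
  rw [this]
  exact MeasurableSet.iInter fun n => (isOpen_lt_infOn hC.isCompact _).measurableSet

/-- The functions that are at least `t` on `C t`, for finitely many levels `t`. -/
def minorized (T : Finset ℝ) (C : ℝ → Set X) : Set (LscFun X) :=
  {f | ∀ t ∈ T, (t : EReal) ≤ f.infOn (C t)}

/-- The sets `minorized T C` with closed `C t`. -/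
def minorizedSets (X : Type*) [TopologicalSpace X] : Set (Set (LscFun X)) :=
  {A | ∃ (T : Finset ℝ) (C : ℝ → Set X), (∀ t, IsClosed (C t)) ∧ A = minorized T C}

theorem measurableSet_minorized [CompactSpace X] (T : Finset ℝ) {C : ℝ → Set X}
    (hC : ∀ t, IsClosed (C t)) : MeasurableSet (minorized T C) := by
  have : minorized T C = ⋂ t ∈ T, {f : LscFun X | (t : EReal) ≤ f.infOn (C t)} := by
    ext; simp [minorized]
  rw [this]
  exact Finset.measurableSet_biInter T fun t _ => measurableSet_le_infOn (hC t) t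

theorem isPiSystem_minorizedSets : IsPiSystem (minorizedSets X) := by
  classical
  rintro _ ⟨T, C, hC, rfl⟩ _ ⟨T', C', hC', rfl⟩ -
  -- Closed sets at a common level are united; a level absent from one family contributes the empty
  -- set, which imposes no condition.
  refine ⟨T ∪ T', fun t => (if t ∈ T then C t else ∅) ∪ (if t ∈ T' then C' t else ∅),
    fun t => ?_, ?_⟩
  · refine IsClosed.union ?_ ?_
    · split_ifs
      exacts [hC t, isClosed_empty]
    · split_ifs
      exacts [hC' t, isClosed_empty]
  · ext f
    simp only [minorized, Set.mem_inter_iff, Set.mem_ofPred_eq, le_infOn_iff, Finset.mem_union]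
    constructor
    · rintro ⟨h, h'⟩ t - x (hx | hx)
      · split_ifs at hx with ht
        exacts [h t ht x hx, hx.elim]
      · split_ifs at hx with ht
        exacts [h' t ht x hx, hx.elim]
    · refine fun h => ⟨fun t ht x hx => h t (Or.inl ht) x (Or.inl ?_),
        fun t ht x hx => h t (Or.inr ht) x (Or.inr ?_)⟩
      · simpa [ht] using hx
      · simpa [ht] using hx

theorem setOf_le_infOn_mem_minorizedSets {C : Set X} (hC : IsClosed C) (t : ℝ) :
    {f : LscFun X | (t : EReal) ≤ f.infOn C} ∈ minorizedSets X :=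
  ⟨{t}, fun _ => C, fun _ => hC, by simp [minorized]⟩

end Basic

/-! ### A countable subbasis on a compact space -/

section SecondCountable

variable {X : Type*} [TopologicalSpace X] [SecondCountableTopology X]

open TopologicalSpace

/-- A countable subbasis of the topology of `Γ`-convergence. -/
def countableSubbasis (X : Type*) [TopologicalSpace X] [SecondCountableTopology X] :
    Set (Set (LscFun X)) :=
  (fun p : Set X × ℚ => {f : LscFun X | f.infOn p.1 < ((p.2 : ℝ) : EReal)}) ''
      (countableBasis X ×ˢ Set.univ) ∪
    (fun p : Set (Set X) × ℚ => {f : LscFun X | ((p.2 : ℝ) : EReal) < f.infOn (⋃₀ p.1)ᶜ}) ''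
      ({F | F.Finite ∧ F ⊆ countableBasis X} ×ˢ Set.univ)

theorem countable_countableSubbasis : (countableSubbasis X).Countable :=
  (((countable_countableBasis X).prod Set.countable_univ).image _).union
    (((Set.countable_ofPred_finite_subset (countable_countableBasis X)).prod
      Set.countable_univ).image _)

/-- The sublevel set `{f ≤ s}` is closed, hence compact, and misses `K`; finitely many basic open
sets disjoint from `K` cover it. This replaces arbitrary compact sets by countably many. -/
theorem exists_finite_basis_separating [CompactSpace X] {K : Set X} (hK : IsClosed K) {s : ℝ} {f : LscFun X}
    (hs : ∀ x ∈ K, (s : EReal) < f.toFun x) :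
    ∃ F : Set (Set X), F.Finite ∧ F ⊆ countableBasis X ∧ K ⊆ (⋃₀ F)ᶜ ∧
      ∀ x ∈ (⋃₀ F)ᶜ, (s : EReal) < f.toFun x := by
  have hcl : IsClosed {x | f.toFun x ≤ s} := f.lsc.isClosed_preimage s
  obtain ⟨F, hFsub, hFfin, hcov⟩ := hcl.isCompact.elim_finite_subcover_image
    (b := {V | V ∈ countableBasis X ∧ V ⊆ Kᶜ}) (c := id)
    (fun V hV => isOpen_of_mem_countableBasis hV.1) (fun x hx => by
      have hxK : x ∈ Kᶜ := fun h => (hs x h).not_ge hx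
      obtain ⟨V, hV, hxV, hVK⟩ :=
        (isBasis_countableBasis X).exists_subset_of_mem_open hxK hK.isOpen_compl
      exact Set.mem_biUnion (show V ∈ {V | V ∈ countableBasis X ∧ V ⊆ Kᶜ} from ⟨hV, hVK⟩) hxV)
  refine ⟨F, hFfin, fun V hV => (hFsub hV).1, ?_, fun x hx => ?_⟩
  · rintro x hx ⟨V, hV, hxV⟩
    exact (hFsub hV).2 hxV hx
  · by_contra h
    obtain ⟨V, hV, hxV⟩ := Set.mem_iUnion₂.1 (hcov (not_lt.1 h))
    exact hx ⟨V, hV, hxV⟩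

theorem isClosed_compl_sUnion_basis {F : Set (Set X)} (hF : F ⊆ countableBasis X) :
    IsClosed (⋃₀ F)ᶜ :=
  (isOpen_sUnion fun _ hV => isOpen_of_mem_countableBasis (hF hV)).isClosed_compl

theorem topology_eq_generateFrom [CompactSpace X] [T2Space X] :
    (inferInstance : TopologicalSpace (LscFun X)) = generateFrom (countableSubbasis X) := by
  refine le_antisymm (le_generateFrom ?_) (le_inf (le_generateFrom ?_) (le_generateFrom ?_))
  · rintro _ (⟨⟨U, q⟩, ⟨hU, -⟩, rfl⟩ | ⟨⟨F, q⟩, ⟨⟨-, hF⟩, -⟩, rfl⟩)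
    · exact isOpen_infOn_lt (isOpen_of_mem_countableBasis hU) q
    · exact isOpen_lt_infOn (isClosed_compl_sUnion_basis hF).isCompact q
  · rintro _ ⟨U, hU, t, rfl⟩
    let _ := generateFrom (countableSubbasis X)
    rw [isOpen_iff_forall_mem_open]
    intro f hf
    obtain ⟨x, hxU, hx⟩ := infOn_lt_iff.1 hf
    obtain ⟨q, hfq, hqt⟩ := EReal.lt_iff_exists_rat_btwn.1 hx
    obtain ⟨V, hV, hxV, hVU⟩ := (isBasis_countableBasis X).exists_subset_of_mem_open hxU hU
    refine ⟨_, fun g hg => ?_, isOpen_generateFrom_of_mem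
      (Or.inl ⟨(V, q), ⟨hV, Set.mem_univ _⟩, rfl⟩), infOn_lt_iff.2 ⟨x, hxV, hfq⟩⟩
    obtain ⟨y, hy, hgy⟩ := infOn_lt_iff.1 hg
    exact infOn_lt_iff.2 ⟨y, hVU hy, hgy.trans hqt⟩
  · rintro _ ⟨K, hK, t, rfl⟩
    let _ := generateFrom (countableSubbasis X)
    rw [isOpen_iff_forall_mem_open]
    intro f hf
    obtain ⟨q, htq, hqf⟩ := EReal.lt_iff_exists_rat_btwn.1 hf
    obtain ⟨F, hFfin, hF, hKF, hlt⟩ :=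
      exists_finite_basis_separating hK.isClosed ((coe_lt_infOn_iff hK).1 hqf)
    refine ⟨_, fun g hg => ?_, isOpen_generateFrom_of_mem
      (Or.inr ⟨(F, q), ⟨⟨hFfin, hF⟩, Set.mem_univ _⟩, rfl⟩),
      (coe_lt_infOn_iff (isClosed_compl_sUnion_basis hF).isCompact).2 hlt⟩
    exact htq.trans (lt_of_lt_of_le hg (le_infOn_iff.2 fun x hx => le_infOn_iff.1 le_rfl x (hKF hx)))

instance [CompactSpace X] [T2Space X] : SecondCountableTopology (LscFun X) :=
  ⟨⟨_, countable_countableSubbasis, topology_eq_generateFrom⟩⟩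

end SecondCountable

/-! ### The Borel σ-algebra is generated by the π-system -/

section Generate

variable {X : Type*} [PseudoMetricSpace X] [T2Space X] [CompactSpace X]

/-- The countable subbasis generates the Borel σ-algebra. An open set of a metric space is a
countable union of closed sets, and strict bounds are countable unions of non-strict rational ones,
so every subbasic set comes from events `t ≤ f.infOn C` with `C` closed. -/
theorem borel_eq_generateFrom_minorizedSets :
    borel (LscFun X) = MeasurableSpace.generateFrom (minorizedSets X) := by
  refine le_antisymm ?_ (MeasurableSpace.generateFrom_le ?_)
  · rw [borel_eq_generateFrom_of_subbasis (topology_eq_generateFrom (X := X))]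
    let _ := MeasurableSpace.generateFrom (minorizedSets X)
    have hmeas : ∀ {C : Set X}, IsClosed C → ∀ t : ℝ,
        MeasurableSet {f : LscFun X | (t : EReal) ≤ f.infOn C} := fun hC t =>
      MeasurableSpace.measurableSet_generateFrom (setOf_le_infOn_mem_minorizedSets hC t)
    refine MeasurableSpace.generateFrom_le ?_
    rintro _ (⟨⟨U, q⟩, ⟨hU, -⟩, rfl⟩ | ⟨⟨F, q⟩, ⟨⟨-, hF⟩, -⟩, rfl⟩)
    · obtain ⟨G, hG, -, hGU, -⟩ :=
        (TopologicalSpace.isOpen_of_mem_countableBasis hU).exists_iUnion_isClosed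
      have : {f : LscFun X | f.infOn U < ((q : ℝ) : EReal)} =
          ⋃ n, {f : LscFun X | ((q : ℝ) : EReal) ≤ f.infOn (G n)}ᶜ := by
        ext f
        rw [← show ⋃ n, G n = U from hGU]
        simp [infOn_iUnion, iInf_lt_iff]
      change MeasurableSet {f : LscFun X | f.infOn U < ((q : ℝ) : EReal)}
      rw [this]
      exact MeasurableSet.iUnion fun n => (hmeas (hG n) _).compl
    · have : {f : LscFun X | ((q : ℝ) : EReal) < f.infOn (⋃₀ F)ᶜ} =
          ⋃ r : ℚ, ⋃ _ : q < r, {f : LscFun X | ((r : ℝ) : EReal) ≤ f.infOn (⋃₀ F)ᶜ} := by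
        ext f
        simp only [Set.mem_ofPred_eq, Set.mem_iUnion, exists_prop]
        constructor
        · intro h
          obtain ⟨r, hqr, hr⟩ := EReal.lt_iff_exists_rat_btwn.1 h
          exact ⟨r, by exact_mod_cast EReal.coe_lt_coe_iff.1 hqr, hr.le⟩
        · rintro ⟨r, hqr, hr⟩
          exact lt_of_lt_of_le (EReal.coe_lt_coe_iff.2 (by exact_mod_cast hqr)) hr
      change MeasurableSet {f : LscFun X | ((q : ℝ) : EReal) < f.infOn (⋃₀ F)ᶜ}
      rw [this]
      exact MeasurableSet.iUnion fun r => MeasurableSet.iUnion fun _ =>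
        hmeas (isClosed_compl_sUnion_basis hF) _
  · rintro _ ⟨T, C, hC, rfl⟩
    exact measurableSet_minorized T hC

end Generate

end LscFun

namespace LscFun

/-! ### Uniqueness of the extremal law -/

section Uniqueness

theorem exists_closed_exhaustion {X : Type*} [PseudoMetricSpace X] {C B : Set X} (hC : IsClosed C) (hB : IsClosed B) :
    ∃ F : ℕ → Set X, (∀ n, IsClosed (F n)) ∧ (⋃ n, F n) = C \ B ∧ Monotone F := by
  obtain ⟨G, hG, -, hGU, hmono⟩ := hB.isOpen_compl.exists_iUnion_isClosed
  refine ⟨fun n => C ∩ G n, fun n => hC.inter (hG n), ?_,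
    fun m n hmn => Set.inter_subset_inter_right _ (hmono hmn)⟩
  rw [← Set.inter_iUnion, hGU, Set.sdiff_eq]

theorem _root_.IsExtremalLaw.measure_minorized {X : Type*} [TopologicalSpace X]
    [MeasurableSpace X] {vol : Measure X} {lam : X → ℝ} {ν : Measure (LscFun X)}
    (hν : IsExtremalLaw vol lam ν) (T : Finset ℝ) {C : ℝ → Set X} (hC : ∀ t, IsClosed (C t))
    (hdisj : ∀ s ∈ T, ∀ t ∈ T, s ≠ t → Disjoint (C s) (C t)) :
    ν (minorized T C) = ∏ t ∈ T, extExpMeasure (∫ x in C t, lam x ∂vol) (Set.Ici (t : EReal)) := by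
  let e := T.equivFin.symm
  have hind := hν.iIndepFun_infOn T.card (fun i => C (e i)) (fun i => hC _) fun i j hij =>
    hdisj _ (e i).2 _ (e j).2 fun h => hij (e.injective (Subtype.ext h))
  have h := hind.measure_inter_preimage_eq_mul Finset.univ
    (sets := fun i => Set.Ici (((e i : ℝ)) : EReal)) (fun i _ => measurableSet_Ici)
  have hset : minorized T C = ⋂ i ∈ (Finset.univ : Finset (Fin T.card)),
      (fun f : LscFun X => f.infOn (C (e i))) ⁻¹' Set.Ici (((e i : ℝ)) : EReal) := by
    ext f
    simp only [minorized, Set.mem_ofPred_eq, Finset.mem_univ, Set.iInter_true, Set.mem_iInter,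
      Set.mem_preimage, Set.mem_Ici]
    refine ⟨fun h i => h _ (e i).2, fun h t ht => ?_⟩
    simpa using h (e.symm ⟨t, ht⟩)
  rw [hset, h, ← Finset.prod_coe_sort T, ← e.prod_comp]
  refine Finset.prod_congr rfl fun i _ => ?_
  have hl := hν.hasLaw_infOn (C (e i)) (hC _)
  rw [← hl.map_eq, Measure.map_apply_of_aemeasurable hl.aemeasurable measurableSet_Ici]

/-- The part of `C t` that is not covered by the `C s` with higher levels `s ∈ T`. -/
def topLevel {X : Type*} (T : Finset ℝ) (C : ℝ → Set X) (t : ℝ) : Set X :=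
  C t \ ⋃ s ∈ T.filter (t < ·), C s

/-- At a point `x`, the constraint of the largest level `t ∈ T` with `x ∈ C t` implies all the
others. -/
theorem minorized_topLevel {X : Type*} [TopologicalSpace X] (T : Finset ℝ) (C : ℝ → Set X) :
    minorized T (topLevel T C) = minorized T C := by
  ext f
  simp only [minorized, Set.mem_ofPred_eq, le_infOn_iff]
  refine ⟨fun h t ht x hx => ?_, fun h t ht x hx => h t ht x hx.1⟩
  classical
  have hne : (T.filter (x ∈ C ·)).Nonempty := ⟨t, Finset.mem_filter.2 ⟨ht, hx⟩⟩
  obtain ⟨m, hm, hmax⟩ := (T.filter (x ∈ C ·)).exists_max_image id hne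
  rw [Finset.mem_filter] at hm
  refine le_trans (EReal.coe_le_coe_iff.2 (hmax t (Finset.mem_filter.2 ⟨ht, hx⟩)))
    (h m hm.1 x ⟨hm.2, ?_⟩)
  simp only [Set.mem_iUnion, Finset.mem_filter, not_exists, exists_prop, not_and]
  exact fun s hs hxs => not_lt_of_ge (hmax s (Finset.mem_filter.2 ⟨hs.1, hxs⟩)) hs.2

theorem topLevel_disjoint {X : Type*} {T : Finset ℝ} (C : ℝ → Set X) {s t : ℝ}
    (hs : s ∈ T) (ht : t ∈ T) (hst : s ≠ t) : Disjoint (topLevel T C s) (topLevel T C t) := by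
  wlog h : s < t generalizing s t
  · exact (this ht hs hst.symm (lt_of_le_of_ne (not_lt.1 h) hst.symm)).symm
  rw [Set.disjoint_left]
  intro x hx hx'
  exact hx.2 (Set.mem_biUnion (Finset.mem_coe.2 (Finset.mem_filter.2 ⟨ht, h⟩)) hx'.1)

/-- The sets `topLevel T C t` are disjoint but need not be closed. Increasing closed exhaustions
stay disjoint, so both laws agree on the corresponding events, and continuity from above passes to
the limit. -/
theorem _root_.IsExtremalLaw.eq {X : Type*} [PseudoMetricSpace X] [T2Space X] [CompactSpace X]
    [MeasurableSpace X] {vol : Measure X} {lam : X → ℝ} {ν ν' : Measure (LscFun X)} [IsProbabilityMeasure ν]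
    [IsProbabilityMeasure ν'] (hν : IsExtremalLaw vol lam ν) (hν' : IsExtremalLaw vol lam ν') :
    ν = ν' := by
  refine ext_of_generate_finite (minorizedSets X) borel_eq_generateFrom_minorizedSets
    isPiSystem_minorizedSets ?_ (by simp)
  rintro _ ⟨T, C, hC, rfl⟩
  have hex : ∀ t, ∃ F : ℕ → Set X, (∀ n, IsClosed (F n)) ∧ (⋃ n, F n) = topLevel T C t ∧
      Monotone F := fun t =>
    exists_closed_exhaustion (hC t) (isClosed_biUnion_finset fun s _ => hC s)
  choose F hF hFU hmono using hex
  have hsub : ∀ t n, F t n ⊆ topLevel T C t := fun t n => hFU t ▸ Set.subset_iUnion (F t) n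
  have hset : minorized T C = ⋂ n, minorized T (fun t => F t n) := by
    rw [← minorized_topLevel]
    ext f
    simp only [minorized, Set.mem_ofPred_eq, Set.mem_iInter, ← hFU, infOn_iUnion, le_iInf_iff]
    exact ⟨fun h n t ht => h t ht n, fun h t ht n => h n t ht⟩
  have hanti : Antitone fun n => minorized T (fun t => F t n) := fun m n hmn f hf t ht =>
    le_infOn_iff.2 fun x hx => le_infOn_iff.1 (hf t ht) x (hmono t hmn hx)
  have hlim : ∀ ρ : Measure (LscFun X), IsProbabilityMeasure ρ →
      Tendsto (fun n => ρ (minorized T (fun t => F t n))) atTop (𝓝 (ρ (minorized T C))) := by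
    intro ρ _
    rw [hset]
    exact tendsto_measure_iInter_atTop
      (fun n => (measurableSet_minorized T fun t => hF t n).nullMeasurableSet) hanti
      ⟨0, measure_ne_top _ _⟩
  refine tendsto_nhds_unique (hlim ν inferInstance) ((hlim ν' inferInstance).congr fun n => ?_)
  have hd : ∀ s ∈ T, ∀ t ∈ T, s ≠ t → Disjoint (F s n) (F t n) := fun s hs t ht hst =>
    (topLevel_disjoint C hs ht hst).mono (hsub s n) (hsub t n)
  rw [hν.measure_minorized T (fun t => hF t n) hd, hν'.measure_minorized T (fun t => hF t n) hd]

end Uniqueness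

end LscFun

/-! ### The integral identity for one exponential waiting time -/

section ExponentialIdentity

variable {X : Type*} [MeasurableSpace X] {p : Measure X} [IsProbabilityMeasure p] {h : X → ℝ}

theorem integrable_max_const (hint : Integrable h p) (u : ℝ) :
    Integrable (fun x => max (h x) u) p :=
  hint.sup (integrable_const u)

theorem lipschitzWith_integral_max (hint : Integrable h p) :
    LipschitzWith 1 fun u => ∫ x, max (h x) u ∂p := by
  refine LipschitzWith.of_le_add fun u v => ?_
  have : ∫ x, max (h x) u ∂p ≤ ∫ x, (max (h x) v + dist u v) ∂p := by
    refine integral_mono (integrable_max_const hint u)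
      ((integrable_max_const hint v).add (integrable_const _)) fun x => ?_
    have h1 : u ≤ v + dist u v := by
      rw [Real.dist_eq]; linarith [le_abs_self (u - v)]
    exact max_le ((le_max_left _ _).trans (le_add_of_nonneg_right dist_nonneg))
      (h1.trans (by gcongr; exact le_max_right _ _))
  rwa [integral_add (integrable_max_const hint v) (integrable_const _), integral_const,
    probReal_univ, one_smul] at this

/-- Difference quotients of `max (h x) ·` are bounded by 1, and from the right they tend to 1 if `h
x ≤ u` and to 0 otherwise, so dominated convergence applies. Only the right derivative has this
value in general: where `h x = u` the left one is 0. -/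
theorem hasDerivWithinAt_integral_max (hm : Measurable h) (hint : Integrable h p) (u : ℝ) :
    HasDerivWithinAt (fun v => ∫ x, max (h x) v ∂p) (p.real {x | h x ≤ u}) (Set.Ioi u) u := by
  rw [hasDerivWithinAt_iff_tendsto_slope' (by simp)]
  have hmeas : MeasurableSet {x | h x ≤ u} := measurableSet_le hm measurable_const
  rw [← integral_indicator_one hmeas]
  have hslope : ∀ v, slope (fun v => ∫ x, max (h x) v ∂p) u v =
      ∫ x, (v - u)⁻¹ * (max (h x) v - max (h x) u) ∂p := fun v => by
    rw [integral_const_mul, integral_sub (integrable_max_const hint v)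
      (integrable_max_const hint u), slope_def_field, div_eq_inv_mul]
  refine Tendsto.congr (fun v => (hslope v).symm) ?_
  refine tendsto_integral_filter_of_dominated_convergence (fun _ => (1 : ℝ)) ?_ ?_
    (integrable_const _) ?_
  · exact Eventually.of_forall fun v => (by fun_prop : Measurable _).aestronglyMeasurable
  · filter_upwards [self_mem_nhdsWithin] with v hv
    refine Eventually.of_forall fun x => ?_
    have hvu : 0 < v - u := sub_pos.2 hv
    rw [norm_mul, norm_inv, Real.norm_of_nonneg hvu.le, inv_mul_le_iff₀ hvu, mul_one]
    refine (abs_max_sub_max_le_abs v u (h x) |> fun hh => ?_)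
    rw [max_comm _ v, max_comm _ u]
    exact hh.trans (abs_of_pos hvu).le
  · refine Eventually.of_forall fun x => ?_
    by_cases hx : h x ≤ u
    · rw [Set.indicator_of_mem (show x ∈ {x | h x ≤ u} from hx)]
      refine tendsto_const_nhds.congr' ?_
      filter_upwards [self_mem_nhdsWithin] with v hv
      have hvu : 0 < v - u := sub_pos.2 hv
      rw [max_eq_right hx, max_eq_right (hx.trans (le_of_lt hv)), inv_mul_cancel₀ hvu.ne']
      rfl
    · rw [Set.indicator_of_notMem (show x ∉ {x | h x ≤ u} from hx)]
      refine tendsto_const_nhds.congr' ?_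
      filter_upwards [mem_nhdsWithin_of_mem_nhds (Iio_mem_nhds (not_le.1 hx))] with v hv
      rw [max_eq_left (le_of_lt hv), max_eq_left (not_le.1 hx).le, sub_self, mul_zero]

theorem le_integral_max (hint : Integrable h p) (u : ℝ) : u ≤ ∫ x, max (h x) u ∂p := by
  have := integral_mono (integrable_const u) (integrable_max_const hint u)
    (fun x => le_max_right (h x) u)
  simpa using this

theorem measurable_measureReal_le (h : X → ℝ) : Measurable fun u => p.real {x | h x ≤ u} :=
  Monotone.measurable fun _ _ huv => measureReal_mono fun _ hx => le_trans hx huv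

theorem integrableOn_exp_integral_max {L : ℝ} (hL : 0 < L) (hint : Integrable h p) :
    IntegrableOn (fun u => L * p.real {x | h x ≤ u} * Real.exp (-(L * ∫ x, max (h x) u ∂p)))
      (Set.Ioi 0) := by
  have hb : IntegrableOn (fun u => L * Real.exp (-L * u)) (Set.Ioi 0) :=
    (integrableOn_exp_mul_Ioi (neg_lt_zero.2 hL) 0).const_mul L
  have hc : Measurable fun u => ∫ x, max (h x) u ∂p :=
    (lipschitzWith_integral_max hint).continuous.measurable
  have hq := measurable_measureReal_le (p := p) h
  refine hb.mono' (by fun_prop : Measurable _).aestronglyMeasurable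
    (Eventually.of_forall fun u => ?_)
  rw [Real.norm_of_nonneg (by positivity)]
  refine mul_le_mul (mul_le_of_le_one_right hL.le measureReal_le_one)
    (Real.exp_le_exp.2 ?_) (by positivity) hL.le
  nlinarith [le_integral_max hint u]

/-- The integrand is the right derivative of `-exp (-(L * φ u))`, and this function vanishes at
infinity because `φ u ≥ u`. -/
theorem integral_exp_integral_max {L : ℝ} (hL : 0 < L) (hm : Measurable h)
    (hint : Integrable h p) :
    ∫ u in Set.Ioi 0, L * p.real {x | h x ≤ u} * Real.exp (-(L * ∫ x, max (h x) u ∂p)) =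
      Real.exp (-(L * ∫ x, max (h x) 0 ∂p)) := by
  set φ : ℝ → ℝ := fun u => ∫ x, max (h x) u ∂p with hφ
  have hI := integrableOn_exp_integral_max hL hint
  have hcont : Continuous φ := (lipschitzWith_integral_max hint).continuous
  have hlim := intervalIntegral_tendsto_integral_Ioi 0 hI tendsto_id
  have heq : ∀ b : ℝ, 0 ≤ b →
      (∫ u in (0 : ℝ)..b, L * p.real {x | h x ≤ u} * Real.exp (-(L * φ u))) =
        -Real.exp (-(L * φ b)) - -Real.exp (-(L * φ 0)) := by
    intro b hb
    refine intervalIntegral.integral_eq_sub_of_hasDeriv_right_of_le hb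
      (f := fun u => -Real.exp (-(L * φ u))) (by fun_prop) (fun u _ => ?_) ?_
    · have := (((hasDerivWithinAt_integral_max hm hint u).const_mul L).neg.exp).neg
      refine this.congr_deriv ?_
      simp only [hφ, Pi.neg_apply]
      ring
    · rw [intervalIntegrable_iff_integrableOn_Ioc_of_le hb]
      exact hI.mono_set fun x hx => hx.1
  have hzero : Tendsto (fun b => Real.exp (-(L * φ b))) atTop (𝓝 0) := by
    refine Real.tendsto_exp_neg_atTop_nhds_zero.comp
      (Tendsto.const_mul_atTop hL (tendsto_atTop_mono (le_integral_max hint) tendsto_id))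
  refine tendsto_nhds_unique hlim ?_
  have h2 : Tendsto (fun b => -Real.exp (-(L * φ b)) - -Real.exp (-(L * φ 0))) atTop
      (𝓝 (Real.exp (-(L * φ 0)))) := by
    simpa using hzero.neg.sub_const (-Real.exp (-(L * φ 0)))
  refine h2.congr' ?_
  filter_upwards [eventually_ge_atTop 0] with b hb
  exact (heq b hb).symm

theorem lintegral_expMeasure {L : ℝ} {f : ℝ → ENNReal} (hf : Measurable f) :
    ∫⁻ u, f u ∂(expMeasure L) =
      ∫⁻ u in Set.Ioi 0, ENNReal.ofReal (L * Real.exp (-(L * u))) * f u := by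
  have hpdf : Measurable (exponentialPDF L) := (measurable_exponentialPDFReal L).ennreal_ofReal
  change ∫⁻ u, f u ∂(volume.withDensity (exponentialPDF L)) = _
  rw [lintegral_withDensity_eq_lintegral_mul _ hpdf hf, ← lintegral_indicator measurableSet_Ioi]
  refine lintegral_congr_ae ?_
  filter_upwards [Measure.ae_ne volume (0 : ℝ)] with u hu
  by_cases h0 : 0 < u
  · simp [h0, exponentialPDF_eq, h0.le]
  · have : u < 0 := lt_of_le_of_ne (not_lt.1 h0) hu
    simp [h0, exponentialPDF_of_neg this]

theorem measurable_measure_le (p : Measure X) (h : X → ℝ) : Measurable fun u => p {x | h x ≤ u} :=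
  Monotone.measurable fun _ _ huv => measure_mono fun _ hx => le_trans hx huv

/-- The probability that no point of a Poisson process lies below `h`, as seen from time `s`. -/
noncomputable def voidProb (p : Measure X) (L : ℝ) (h : X → ℝ) (s : ℝ) : ENNReal :=
  ENNReal.ofReal (Real.exp (-(L * ∫ x, max (h x - s) 0 ∂p)))

theorem integral_max_sub (hint : Integrable h p) (s : ℝ) :
    ∫ x, max (h x - s) 0 ∂p = (∫ x, max (h x) s ∂p) - s := by
  have : ∀ x, max (h x - s) 0 = max (h x) s - s := fun x => by rw [← max_sub_sub_right, sub_self]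
  simp_rw [this]
  rw [integral_sub (integrable_max_const hint s) (integrable_const s)]
  simp

theorem measurable_voidProb (L : ℝ) (hint : Integrable h p) : Measurable (voidProb p L h) := by
  have hc : Measurable fun u => ∫ x, max (h x) u ∂p :=
    (lipschitzWith_integral_max hint).continuous.measurable
  unfold voidProb
  simp_rw [integral_max_sub hint]
  fun_prop

/-- The renewal equation at the next arrival, at time `s + u`: its point must satisfy `h ≤ s + u`,
and afterwards the process starts afresh. The factor exp(-Lu) of the exponential density cancels
against the shift in `voidProb`, leaving `integral_exp_integral_max` for `h - s`. -/
theorem lintegral_expMeasure_voidProb {L : ℝ} (hL : 0 < L) (hm : Measurable h)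
    (hint : Integrable h p) (s : ℝ) :
    ∫⁻ u, p {x | h x ≤ s + u} * voidProb p L h (s + u) ∂(expMeasure L) = voidProb p L h s := by
  have hq := measurable_measure_le p h
  have hv := measurable_voidProb L hint (p := p)
  have hm' : Measurable fun x => h x - s := by fun_prop
  have hint' : Integrable (fun x => h x - s) p := hint.sub (integrable_const s)
  have hf : Measurable fun u => p {x | h x ≤ s + u} * voidProb p L h (s + u) :=
    (hq.comp (measurable_const_add s)).mul (hv.comp (measurable_const_add s))
  rw [lintegral_expMeasure hf, voidProb, ← integral_exp_integral_max hL hm' hint',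
    ofReal_integral_eq_lintegral_ofReal (integrableOn_exp_integral_max hL hint')
      (Eventually.of_forall fun u => by positivity)]
  refine lintegral_congr fun u => ?_
  have hset : {x | h x ≤ s + u} = {x | h x - s ≤ u} := by
    ext x; simp only [Set.mem_ofPred_eq, sub_le_iff_le_add']
  have hmax := integral_max_sub hint' u
  simp_rw [sub_sub] at hmax
  rw [hset, voidProb, hmax, mul_left_comm, ← ENNReal.ofReal_mul (by positivity),
    ← ofReal_measureReal, ← ENNReal.ofReal_mul (by positivity)]
  have hexp : ∀ I : ℝ, Real.exp (-(L * I)) =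
      Real.exp (-(L * u)) * Real.exp (-(L * (I - u))) := fun I => by
    rw [← Real.exp_add]
    ring_nf
  rw [hexp (∫ x, max (h x - s) u ∂p)]
  congr 1
  ring

end ExponentialIdentity

/-! ### The void probability of the marked arrival process -/

section VoidProbability

variable {X : Type*} [MeasurableSpace X] {p : Measure X} {h : X → ℝ}
  {Ω : Type*} [MeasurableSpace Ω] {P : Measure Ω}
  {x : ℕ → Ω → X} {ξ : ℕ → Ω → ℝ} {L : ℝ}

theorem measurable_prod_measure_le (p : Measure X) (h : X → ℝ) (n : ℕ) :
    Measurable fun b : ℕ → ℝ =>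
      ∏ i ∈ Finset.range n, p {y | h y ≤ ∑ j ∈ Finset.range (i + 1), b j} :=
  Finset.measurable_prod _ fun _ _ => (measurable_measure_le p h).comp
    (Finset.measurable_sum _ fun j _ => measurable_pi_apply j)

/-- Functions of the first `n` variables of an independent sequence are independent of the next
variable. -/
theorem indepFun_of_range {E : Type*} [MeasurableSpace E] (hξ : ∀ j, Measurable (ξ j))
    (hind : iIndepFun ξ P) {n : ℕ} {Φ : (ℕ → ℝ) → E} (hΦ : Measurable Φ)
    (hdep : ∀ a b : ℕ → ℝ, (∀ j < n, a j = b j) → Φ a = Φ b) :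
    IndepFun (fun ω => Φ fun j => ξ j ω) (ξ n) P := by
  classical
  have hi := hind.indepFun_finset (Finset.range n) {n} (by simp) hξ
  -- Padding by 0 is harmless: by `hdep`, `Φ` ignores all coordinates from `n` on.
  let ext : (Finset.range n → ℝ) → ℕ → ℝ := fun a j =>
    if hj : j ∈ Finset.range n then a ⟨j, hj⟩ else 0
  have hext : Measurable ext := by
    refine measurable_pi_lambda _ fun j => ?_
    by_cases hj : j ∈ Finset.range n
    · simpa only [ext, hj, dite_true] using measurable_pi_apply _
    · simp only [ext, hj, dite_false, measurable_const]
  have hlast : Measurable fun a : ({n} : Finset ℕ) → ℝ => a ⟨n, Finset.mem_singleton_self n⟩ :=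
    measurable_pi_apply _
  have hcomp := hi.comp (hΦ.comp hext) hlast
  have heq : (fun ω => Φ fun j => ξ j ω) =
      (Φ ∘ ext) ∘ fun ω (i : Finset.range n) => ξ i ω := by
    funext ω
    refine hdep _ _ fun j hj => ?_
    simp [ext, hj]
  rw [heq]
  exact hcomp

/-- Martingale property: integrating out the last waiting time, which is independent of the earlier
ones, turns the expression for `n + 1` into that for `n` by `lintegral_expMeasure_voidProb`. -/
theorem lintegral_prod_mul_voidProb [IsProbabilityMeasure p] [IsProbabilityMeasure P]
    (hL : 0 < L) (hm : Measurable h) (hint : Integrable h p)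
    (hξ : ∀ j, Measurable (ξ j)) (hlaw : ∀ j, P.map (ξ j) = expMeasure L)
    (hind : iIndepFun ξ P) (n : ℕ) :
    ∫⁻ ω, (∏ i ∈ Finset.range n, p {y | h y ≤ ∑ j ∈ Finset.range (i + 1), ξ j ω}) *
      voidProb p L h (∑ j ∈ Finset.range n, ξ j ω) ∂P = voidProb p L h 0 := by
  induction n with
  | zero => simp
  | succ n ih =>
    have := isProbabilityMeasure_expMeasure hL
    have hv := measurable_voidProb L hint
    have hq := measurable_measure_le p h
    let Φ : (ℕ → ℝ) → ENNReal × ℝ := fun b =>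
      (∏ i ∈ Finset.range n, p {y | h y ≤ ∑ j ∈ Finset.range (i + 1), b j},
        ∑ j ∈ Finset.range n, b j)
    have hΦ : Measurable Φ := (measurable_prod_measure_le p h n).prodMk
      (Finset.measurable_sum _ fun j _ => measurable_pi_apply j)
    have hdep : ∀ a b : ℕ → ℝ, (∀ j < n, a j = b j) → Φ a = Φ b := by
      intro a b hab
      have hsum : ∀ k ≤ n, ∑ j ∈ Finset.range k, a j = ∑ j ∈ Finset.range k, b j := fun k hk =>
        Finset.sum_congr rfl fun j hj => hab j ((Finset.mem_range.1 hj).trans_le hk)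
      refine Prod.ext ?_ (hsum n le_rfl)
      simp only [Φ]
      refine Finset.prod_congr rfl fun i hi => ?_
      rw [hsum (i + 1) (Finset.mem_range.1 hi)]
    have hZ := indepFun_of_range hξ hind hΦ hdep
    have hξω : Measurable fun ω j => ξ j ω := measurable_pi_lambda _ hξ
    have hZm : Measurable fun ω => Φ fun j => ξ j ω := hΦ.comp hξω
    have hF : Measurable fun z : (ENNReal × ℝ) × ℝ =>
        z.1.1 * (p {y | h y ≤ z.1.2 + z.2} * voidProb p L h (z.1.2 + z.2)) := by
      have h1 : Measurable fun z : (ENNReal × ℝ) × ℝ => z.1.2 + z.2 := by fun_prop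
      exact (measurable_fst.comp measurable_fst).mul ((hq.comp h1).mul (hv.comp h1))
    calc
      _ = ∫⁻ ω, (fun z : (ENNReal × ℝ) × ℝ =>
          z.1.1 * (p {y | h y ≤ z.1.2 + z.2} * voidProb p L h (z.1.2 + z.2)))
            (Φ fun j => ξ j ω, ξ n ω) ∂P := by
        refine lintegral_congr fun ω => ?_
        simp only [Φ, Finset.prod_range_succ, Finset.sum_range_succ, mul_assoc]
      _ = ∫⁻ z, z.1 * voidProb p L h z.2 ∂(P.map fun ω => Φ fun j => ξ j ω) := by
        rw [← lintegral_map hF (hZm.prodMk (hξ n)),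
          (indepFun_iff_map_prod_eq_prod_map_map hZm.aemeasurable (hξ n).aemeasurable).1 hZ,
          hlaw, lintegral_prod _ hF.aemeasurable]
        refine lintegral_congr fun z => ?_
        have h1 : Measurable fun u : ℝ => z.2 + u := measurable_const_add _
        have hmeas : Measurable fun u => p {y | h y ≤ z.2 + u} * voidProb p L h (z.2 + u) :=
          (hq.comp h1).mul (hv.comp h1)
        change ∫⁻ u, z.1 * (p {y | h y ≤ z.2 + u} * voidProb p L h (z.2 + u)) ∂(expMeasure L) = _
        rw [lintegral_const_mul _ hmeas,
          lintegral_expMeasure_voidProb hL hm hint]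
      _ = _ := by
        have hmeas : Measurable fun z : ENNReal × ℝ => z.1 * voidProb p L h z.2 :=
          measurable_fst.mul (hv.comp measurable_snd)
        rw [lintegral_map hmeas hZm]
        exact ih

theorem measurableSet_forall_le_sum (hm : Measurable h) (hx : ∀ i, Measurable (x i))
    (hξ : ∀ j, Measurable (ξ j)) (n : ℕ) :
    MeasurableSet {ω | ∀ i < n, h (x i ω) ≤ ∑ j ∈ Finset.range (i + 1), ξ j ω} := by
  simp only [Set.ofPred_forall]
  exact MeasurableSet.iInter fun i => MeasurableSet.iInter fun _ =>
    measurableSet_le (hm.comp (hx i)) (Finset.measurable_sum _ fun j _ => hξ j)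

/-- Fubini: with the arrival times frozen, the conditions on the independent points multiply. -/
theorem measure_forall_lt_le_sum [IsProbabilityMeasure P] (hm : Measurable h) (hx : ∀ i, Measurable (x i))
    (hxlaw : ∀ i, P.map (x i) = p) (hxind : iIndepFun x P) (hξ : ∀ j, Measurable (ξ j))
    (hxξ : IndepFun (fun ω i => x i ω) (fun ω j => ξ j ω) P) (n : ℕ) :
    P {ω | ∀ i < n, h (x i ω) ≤ ∑ j ∈ Finset.range (i + 1), ξ j ω} =
      ∫⁻ ω, ∏ i ∈ Finset.range n, p {y | h y ≤ ∑ j ∈ Finset.range (i + 1), ξ j ω} ∂P := by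
  have hxω : Measurable fun ω i => x i ω := measurable_pi_lambda _ hx
  have hξω : Measurable fun ω j => ξ j ω := measurable_pi_lambda _ hξ
  set B : Set ((ℕ → X) × (ℕ → ℝ)) :=
    {z | ∀ i < n, h (z.1 i) ≤ ∑ j ∈ Finset.range (i + 1), z.2 j} with hBdef
  have hB : MeasurableSet B := measurableSet_forall_le_sum hm
    (x := fun i (z : (ℕ → X) × (ℕ → ℝ)) => z.1 i) (ξ := fun j z => z.2 j)
    (fun i => (measurable_pi_apply i).comp measurable_fst)
    (fun j => (measurable_pi_apply j).comp measurable_snd) n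
  have h1 : P {ω | ∀ i < n, h (x i ω) ≤ ∑ j ∈ Finset.range (i + 1), ξ j ω} =
      P.map (fun ω => ((fun i => x i ω), fun j => ξ j ω)) B :=
    (Measure.map_apply (hxω.prodMk hξω) hB).symm
  have := Measure.isProbabilityMeasure_map (μ := P) hxω.aemeasurable
  have := Measure.isProbabilityMeasure_map (μ := P) hξω.aemeasurable
  rw [h1, (indepFun_iff_map_prod_eq_prod_map_map hxω.aemeasurable hξω.aemeasurable).1 hxξ,
    Measure.prod_apply_symm hB, lintegral_map (measurable_measure_prodMk_right hB) hξω]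
  refine lintegral_congr fun ω => ?_
  rw [Measure.map_apply hxω (measurable_prodMk_right hB)]
  have hset : ∀ i, MeasurableSet {y | h y ≤ ∑ j ∈ Finset.range (i + 1), ξ j ω} := fun i =>
    measurableSet_le hm measurable_const
  have h2 := hxind.measure_inter_preimage_eq_mul (Finset.range n)
    (sets := fun i => {y | h y ≤ ∑ j ∈ Finset.range (i + 1), ξ j ω}) (fun i _ => hset i)
  simp_rw [← Measure.map_apply (hx _) (hset _), hxlaw] at h2
  rw [← h2]
  congr 1
  ext ω'
  simp [hBdef]

/-- Once the arrival time exceeds the bound `H`, the factor `voidProb` is 1. So the products with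
and without it have the same limit; the means of the former are constant, those of the latter are
the probabilities sought. -/
theorem measure_forall_le_sum [IsProbabilityMeasure p] [IsProbabilityMeasure P] (hL : 0 < L) (hm : Measurable h)
    (hint : Integrable h p) {H : ℝ} (hH : ∀ y, h y ≤ H) (hx : ∀ i, Measurable (x i))
    (hxlaw : ∀ i, P.map (x i) = p) (hxind : iIndepFun x P) (hξ : ∀ j, Measurable (ξ j))
    (hlaw : ∀ j, P.map (ξ j) = expMeasure L) (hind : iIndepFun ξ P)
    (hxξ : IndepFun (fun ω i => x i ω) (fun ω j => ξ j ω) P)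
    (hdiv : ∀ ω, Tendsto (fun n => ∑ j ∈ Finset.range n, ξ j ω) atTop atTop) :
    P {ω | ∀ i, h (x i ω) ≤ ∑ j ∈ Finset.range (i + 1), ξ j ω} = voidProb p L h 0 := by
  let f : ℕ → Ω → ENNReal := fun n ω =>
    ∏ i ∈ Finset.range n, p {y | h y ≤ ∑ j ∈ Finset.range (i + 1), ξ j ω}
  have hξω : Measurable fun ω j => ξ j ω := measurable_pi_lambda _ hξ
  have hf : ∀ n, Measurable (f n) := fun n => (measurable_prod_measure_le p h n).comp hξω
  have hf1 : ∀ n ω, f n ω ≤ 1 := fun n ω => Finset.prod_le_one' fun i _ => prob_le_one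
  have hfanti : ∀ ω, Antitone fun n => f n ω := fun ω => antitone_nat_of_succ_le fun n => by
    simp only [f, Finset.prod_range_succ]
    exact mul_le_of_le_one_right' prob_le_one
  have hflim : ∀ ω, Tendsto (fun n => f n ω) atTop (𝓝 (⨅ n, f n ω)) := fun ω =>
    tendsto_atTop_iInf (hfanti ω)
  have hv1 : ∀ s, H ≤ s → voidProb p L h s = 1 := fun s hs => by
    have : ∀ y, max (h y - s) 0 = 0 := fun y => max_eq_right (by linarith [hH y])
    simp [voidProb, this]
  have hle : ∀ s, voidProb p L h s ≤ 1 := fun s => by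
    refine ENNReal.ofReal_le_one.2 (Real.exp_le_one_iff.2 (neg_nonpos.2 ?_))
    exact mul_nonneg hL.le (integral_nonneg fun y => le_max_right _ _)
  have hlim1 : Tendsto (fun n => ∫⁻ ω, f n ω ∂P) atTop (𝓝 (∫⁻ ω, ⨅ n, f n ω ∂P)) :=
    tendsto_lintegral_of_dominated_convergence (fun _ => 1) hf
      (fun n => Eventually.of_forall (hf1 n)) (by simp) (Eventually.of_forall hflim)
  have hlim2 : Tendsto (fun n => ∫⁻ ω, f n ω * voidProb p L h (∑ j ∈ Finset.range n, ξ j ω) ∂P)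
      atTop (𝓝 (∫⁻ ω, ⨅ n, f n ω ∂P)) := by
    refine tendsto_lintegral_of_dominated_convergence (fun _ => 1)
      (fun n => (hf n).mul ((measurable_voidProb L hint).comp
        (Finset.measurable_sum _ fun j _ => hξ j)))
      (fun n => Eventually.of_forall fun ω => mul_le_one' (hf1 n ω) (hle _)) (by simp)
      (Eventually.of_forall fun ω => (hflim ω).congr' ?_)
    filter_upwards [(hdiv ω).eventually_ge_atTop H] with n hn
    rw [hv1 _ hn, mul_one]
  simp_rw [f, lintegral_prod_mul_voidProb hL hm hint hξ hlaw hind] at hlim2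
  rw [tendsto_nhds_unique tendsto_const_nhds hlim2]
  refine tendsto_nhds_unique ?_ hlim1
  have hset : {ω | ∀ i, h (x i ω) ≤ ∑ j ∈ Finset.range (i + 1), ξ j ω} =
      ⋂ n, {ω | ∀ i < n, h (x i ω) ≤ ∑ j ∈ Finset.range (i + 1), ξ j ω} := by
    ext ω
    simp only [Set.mem_ofPred_eq, Set.mem_iInter]
    exact ⟨fun hω n i _ => hω i, fun hω i => hω (i + 1) i (Nat.lt_succ_self i)⟩
  rw [hset]
  refine (tendsto_measure_iInter_atTop
    (fun n => (measurableSet_forall_le_sum hm hx hξ n).nullMeasurableSet)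
    (fun m n hmn ω hω i hi => hω i (hi.trans_le hmn)) ⟨0, measure_ne_top _ _⟩).congr fun n => ?_
  exact measure_forall_lt_le_sum hm hx hxlaw hxind hξ hxξ n

end VoidProbability

/-! ### Survival functions on the extended reals -/

section ExtendedReal

/-- The closed half-lines `[t, +∞]` with real endpoint. -/
def erealRays : Set (Set EReal) := Set.range fun t : ℝ => Set.Ici (t : EReal)

theorem isPiSystem_erealRays : IsPiSystem erealRays := by
  rintro _ ⟨s, rfl⟩ _ ⟨t, rfl⟩ -
  exact ⟨max s t, by simp [Set.Ici_inter_Ici, EReal.coe_strictMono.monotone.map_max]⟩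

theorem borel_ereal_eq_generateFrom_erealRays :
    EReal.measurableSpace = MeasurableSpace.generateFrom erealRays := by
  refine le_antisymm ?_ (MeasurableSpace.generateFrom_le ?_)
  · rw [BorelSpace.measurable_eq (α := EReal), borel_eq_generateFrom_Ici]
    let _ := MeasurableSpace.generateFrom erealRays
    refine MeasurableSpace.generateFrom_le ?_
    rintro _ ⟨a, rfl⟩
    have hcoe : ∀ t : ℝ, MeasurableSet (Set.Ici (t : EReal)) := fun t =>
      MeasurableSpace.measurableSet_generateFrom ⟨t, rfl⟩
    induction a with
    | bot => simp
    | coe t => exact hcoe t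
    | top =>
      have : Set.Ici (⊤ : EReal) = ⋂ n : ℕ, Set.Ici (((n : ℝ)) : EReal) := by
        ext y
        simp only [Set.mem_Ici, top_le_iff, Set.mem_iInter]
        refine ⟨fun h n => h ▸ le_top, fun h => EReal.eq_top_iff_forall_lt y |>.2 fun t => ?_⟩
        obtain ⟨n, hn⟩ := exists_nat_gt t
        exact (EReal.coe_lt_coe_iff.2 hn).trans_le (h n)
      rw [this]
      exact MeasurableSet.iInter fun n => hcoe n
  · rintro _ ⟨t, rfl⟩
    exact measurableSet_Ici

/-- The renewal equation on a one-point space with constant `h = t`: on `{t ≤ u}` the factor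
`voidProb` at `u` is 1. -/
theorem expMeasure_Ici {r : ℝ} (hr : 0 < r) (t : ℝ) :
    expMeasure r (Set.Ici t) = ENNReal.ofReal (Real.exp (-(r * max t 0))) := by
  have h := lintegral_expMeasure_voidProb (p := Measure.dirac ()) (h := fun _ => t) hr
    measurable_const (integrable_const t) 0
  simp only [voidProb, integral_const, probReal_univ, one_smul, zero_add, sub_zero] at h
  rw [← h, ← lintegral_indicator_one measurableSet_Ici]
  refine lintegral_congr fun u => ?_
  by_cases hu : t ≤ u
  · simp [hu]
  · simp [hu]

theorem extExpMeasure_Ici {r : ℝ} (hr : 0 ≤ r) (t : ℝ) :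
    extExpMeasure r (Set.Ici (t : EReal)) = ENNReal.ofReal (Real.exp (-(r * max t 0))) := by
  rcases hr.eq_or_lt with rfl | hr
  · simp [extExpMeasure]
  · rw [extExpMeasure, if_neg hr.ne', Measure.map_apply measurable_coe_real_ereal measurableSet_Ici,
      ← expMeasure_Ici hr]
    congr 1
    ext u
    simp

theorem isProbabilityMeasure_extExpMeasure {r : ℝ} (hr : 0 ≤ r) :
    IsProbabilityMeasure (extExpMeasure r) := by
  rcases hr.eq_or_lt with rfl | hr
  · rw [extExpMeasure, if_pos rfl]
    infer_instance
  · have := isProbabilityMeasure_expMeasure hr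
    rw [extExpMeasure, if_neg hr.ne']
    exact Measure.isProbabilityMeasure_map measurable_coe_real_ereal.aemeasurable

end ExtendedReal

/-! ### Characterization of the extremal law by joint survival functions -/

namespace LscFun

theorem measurable_infOn {X : Type*} [TopologicalSpace X] [CompactSpace X] {C : Set X}
    (hC : IsClosed C) : Measurable fun f : LscFun X => f.infOn C := by
  rw [borel_ereal_eq_generateFrom_erealRays]
  refine measurable_generateFrom ?_
  rintro _ ⟨t, rfl⟩
  exact measurableSet_le_infOn hC t

/-- The joint survival functions of the minima over disjoint closed sets characterize the extremal
law. -/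
theorem _root_.IsExtremalLaw.of_measure_eq {X : Type*} [TopologicalSpace X] [CompactSpace X]
    [MeasurableSpace X] {vol : Measure X} {lam : X → ℝ} {ν : Measure (LscFun X)}
    [IsProbabilityMeasure ν] (hlam : ∀ C, IsClosed C → 0 ≤ ∫ x in C, lam x ∂vol)
    (h : ∀ (k : ℕ) (C : Fin k → Set X), (∀ i, IsClosed (C i)) →
      Pairwise (fun i j => Disjoint (C i) (C j)) → ∀ (S : Finset (Fin k)) (t : Fin k → ℝ),
      ν {f | ∀ i ∈ S, (t i : EReal) ≤ f.infOn (C i)} =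
        ∏ i ∈ S, ENNReal.ofReal (Real.exp (-((∫ x in C i, lam x ∂vol) * max (t i) 0)))) :
    IsExtremalLaw vol lam ν := by
  have hone : ∀ C : Set X, IsClosed C → ∀ t : ℝ, ν {f | (t : EReal) ≤ f.infOn C} =
      ENNReal.ofReal (Real.exp (-((∫ x in C, lam x ∂vol) * max t 0))) := fun C hC t => by
    simpa using h 1 (fun _ => C) (fun _ => hC)
      (fun i j hij => absurd (Subsingleton.elim i j) hij) Finset.univ (fun _ => t)
  refine ⟨fun C hC => ⟨(measurable_infOn hC).aemeasurable, ?_⟩, fun k C hC hdisj => ?_⟩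
  · have := isProbabilityMeasure_extExpMeasure (hlam C hC)
    have := Measure.isProbabilityMeasure_map (μ := ν) (measurable_infOn hC).aemeasurable
    refine ext_of_generate_finite erealRays borel_ereal_eq_generateFrom_erealRays
      isPiSystem_erealRays ?_ (by simp)
    rintro _ ⟨t, rfl⟩
    rw [Measure.map_apply (measurable_infOn hC) measurableSet_Ici, extExpMeasure_Ici (hlam C hC),
      ← hone C hC t]
    rfl
  · refine iIndepSets.iIndep (fun i => (measurable_infOn (hC i)).comap_le)
      (fun i => (fun A => (fun f : LscFun X => f.infOn (C i)) ⁻¹' A) '' erealRays) (fun i => ?_)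
      (fun i => ?_) ?_
    · rintro _ ⟨A, hA, rfl⟩ _ ⟨B, hB, rfl⟩ ⟨f, hfA, hfB⟩
      exact ⟨A ∩ B, isPiSystem_erealRays A hA B hB ⟨f.infOn (C i), hfA, hfB⟩, rfl⟩
    · rw [borel_ereal_eq_generateFrom_erealRays, MeasurableSpace.comap_generateFrom]
    · rw [iIndepSets_iff]
      intro S A hA
      have hex : ∀ i, ∃ t : ℝ, i ∈ S → A i = {f | (t : EReal) ≤ f.infOn (C i)} := fun i => by
        by_cases hi : i ∈ S
        · obtain ⟨_, ⟨t, rfl⟩, ht⟩ := hA i hi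
          exact ⟨t, fun _ => ht.symm⟩
        · exact ⟨0, fun h => absurd h hi⟩
      choose t ht using hex
      have hset : ⋂ i ∈ S, A i = {f | ∀ i ∈ S, (t i : EReal) ≤ f.infOn (C i)} := by
        ext f
        simp only [Set.mem_iInter, Set.mem_ofPred_eq]
        exact forall₂_congr fun i hi => by rw [ht i hi]; rfl
      rw [hset, h k C hC hdisj]
      exact Finset.prod_congr rfl fun i hi => by rw [ht i hi, hone _ (hC i)]

end LscFun

/-! ### The limit function and Γ-convergence to it -/

section ArrivalLimit

variable {X : Type*} [TopologicalSpace X] [T1Space X] {x : ℕ → X} {ξ : ℕ → ℝ}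

theorem le_infOn_arrivalLsc_iff {n : ℕ} {C : Set X} {a : EReal} :
    a ≤ (arrivalLsc x ξ n).infOn C ↔
      ∀ i < n, x i ∈ C → a ≤ ((∑ j ∈ Finset.range (i + 1), ξ j : ℝ) : EReal) := by
  rw [LscFun.le_infOn_iff]
  simp only [arrivalLsc, arrivalFun, le_iInf_iff]
  exact ⟨fun h i hi hx => h _ hx i ⟨hi, rfl⟩, fun h y hy i hi => h i hi.1 (hi.2 ▸ hy)⟩

/-- The limit of `arrivalLsc x ξ n` as `n → ∞`, when the partial sums of `ξ` tend to `+∞`. -/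
noncomputable def arrivalLimit (x : ℕ → X) {ξ : ℕ → ℝ} (hξ : ∀ j, 0 ≤ ξ j)
    (hdiv : Tendsto (fun n => ∑ j ∈ Finset.range n, ξ j) atTop atTop) : LscFun X where
  toFun y := ⨅ i : ℕ, ⨅ _ : x i = y, ((∑ j ∈ Finset.range (i + 1), ξ j : ℝ) : EReal)
  lsc := by
    rw [lowerSemicontinuous_iff_isClosed_preimage]
    intro a
    by_cases ha : a = ⊤
    · simp [ha]
    -- Only finitely many partial sums lie below a real `b > a`, so the sublevel set at `a` is
    -- finite, hence closed.
    obtain ⟨b, hab, -⟩ := EReal.lt_iff_exists_real_btwn.1 (lt_top_iff_ne_top.2 ha)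
    obtain ⟨N, hN⟩ := eventually_atTop.1 (hdiv.eventually_ge_atTop b)
    refine (((Finset.range N).finite_toSet.image x).subset fun y hy => ?_).isClosed
    by_contra h
    refine (hab.trans_le ?_).not_ge (Set.mem_Iic.1 hy)
    refine le_iInf₂ fun i hi => EReal.coe_le_coe_iff.2 (hN (i + 1) ?_)
    by_contra hlt
    exact h ⟨i, by simp; omega, hi⟩
  ne_bot y := by
    refine ne_of_gt ((EReal.bot_lt_coe 0).trans_le (le_iInf₂ fun i _ => ?_))
    exact EReal.coe_le_coe_iff.2 (Finset.sum_nonneg fun j _ => hξ j)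

theorem le_infOn_arrivalLimit_iff {hξ : ∀ j, 0 ≤ ξ j}
    {hdiv : Tendsto (fun n => ∑ j ∈ Finset.range n, ξ j) atTop atTop} {C : Set X} {a : EReal} :
    a ≤ (arrivalLimit x hξ hdiv).infOn C ↔
      ∀ i, x i ∈ C → a ≤ ((∑ j ∈ Finset.range (i + 1), ξ j : ℝ) : EReal) := by
  rw [LscFun.le_infOn_iff]
  simp only [arrivalLimit, le_iInf_iff]
  exact ⟨fun h i hx => h _ hx i rfl, fun h y hy i hi => h i (hi ▸ hy)⟩

/-- The functions lie above the limit, which gives the condition on compact sets; on an open set, a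
value of the limit below `t` is witnessed by one arrival, present for all larger `n`. -/
theorem tendsto_arrivalLsc (hξ : ∀ j, 0 ≤ ξ j)
    (hdiv : Tendsto (fun n => ∑ j ∈ Finset.range n, ξ j) atTop atTop) :
    Tendsto (arrivalLsc x ξ) atTop (𝓝 (arrivalLimit x hξ hdiv)) := by
  refine LscFun.tendsto_nhds_of_infOn (fun U _ t h => ?_) fun K _ t h => ?_
  · rw [← not_le, le_infOn_arrivalLimit_iff] at h
    push Not at h
    obtain ⟨i, hi, hlt⟩ := h
    filter_upwards [eventually_gt_atTop i] with n hn
    rw [← not_le, le_infOn_arrivalLsc_iff]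
    exact fun hle => hlt.not_ge (hle i hn hi)
  · refine Eventually.of_forall fun n => h.trans_le ?_
    exact le_infOn_arrivalLsc_iff.2 fun i _ hi => le_infOn_arrivalLimit_iff.1 le_rfl i hi

end ArrivalLimit

/-! ### Measurability of the random functions -/

section Measurability

variable {X : Type*} [PseudoMetricSpace X] {Ω : Type*} [MeasurableSpace Ω]

theorem LscFun.measurable_of_le_infOn [T2Space X] [CompactSpace X] {F : Ω → LscFun X}
    (hF : ∀ C : Set X, IsClosed C → ∀ t : ℝ, MeasurableSet {ω | (t : EReal) ≤ (F ω).infOn C}) :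
    Measurable F := by
  change @Measurable Ω (LscFun X) _ (borel (LscFun X)) F
  rw [LscFun.borel_eq_generateFrom_minorizedSets]
  refine measurable_generateFrom ?_
  rintro _ ⟨T, C, hC, rfl⟩
  have : F ⁻¹' LscFun.minorized T C = ⋂ t ∈ T, {ω | (t : EReal) ≤ (F ω).infOn (C t)} := by
    ext; simp [LscFun.minorized]
  rw [this]
  exact Finset.measurableSet_biInter T fun t _ => hF _ (hC t) t

variable [MeasurableSpace X] [BorelSpace X] {x : ℕ → Ω → X} {ξ : ℕ → Ω → ℝ}

theorem measurableSet_mem_imp_le_sum (hx : ∀ i, Measurable (x i)) (hξ : ∀ j, Measurable (ξ j))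
    {C : Set X} (hC : IsClosed C) (t : ℝ) (i : ℕ) :
    MeasurableSet {ω | x i ω ∈ C → (t : EReal) ≤
      ((∑ j ∈ Finset.range (i + 1), ξ j ω : ℝ) : EReal)} := by
  simp only [EReal.coe_le_coe_iff]
  exact (hx i hC.measurableSet).imp
    (measurableSet_le measurable_const (Finset.measurable_sum _ fun j _ => hξ j))

theorem measurable_arrivalLsc [T2Space X] [CompactSpace X] (hx : ∀ i, Measurable (x i))
    (hξ : ∀ j, Measurable (ξ j)) (n : ℕ) :
    Measurable fun ω => arrivalLsc (fun i => x i ω) (fun j => ξ j ω) n := by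
  refine LscFun.measurable_of_le_infOn fun C hC t => ?_
  simp only [le_infOn_arrivalLsc_iff, Set.ofPred_forall]
  exact MeasurableSet.iInter fun i => MeasurableSet.iInter fun _ => by
    simpa only [Set.ofPred_forall] using measurableSet_mem_imp_le_sum hx hξ hC t i

theorem measurable_arrivalLimit [T2Space X] [CompactSpace X] (hx : ∀ i, Measurable (x i))
    (hξ : ∀ j, Measurable (ξ j)) (hpos : ∀ ω j, 0 ≤ ξ j ω)
    (hdiv : ∀ ω, Tendsto (fun n => ∑ j ∈ Finset.range n, ξ j ω) atTop atTop) :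
    Measurable fun ω => arrivalLimit (fun i => x i ω) (hpos ω) (hdiv ω) := by
  refine LscFun.measurable_of_le_infOn fun C hC t => ?_
  simp only [le_infOn_arrivalLimit_iff, Set.ofPred_forall]
  exact MeasurableSet.iInter fun i => by
    simpa only [Set.ofPred_forall] using measurableSet_mem_imp_le_sum hx hξ hC t i

end Measurability

/-! ### The limit has the extremal law -/

section LimitLaw

variable {X : Type*} [PseudoMetricSpace X] [T2Space X] [CompactSpace X] [MeasurableSpace X]
  [BorelSpace X] {vol p : Measure X} [IsProbabilityMeasure p] {lam : X → ℝ} {L : ℝ}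
  {Ω : Type*} [MeasurableSpace Ω] {P : Measure Ω} [IsProbabilityMeasure P]
  {x : ℕ → Ω → X} {ξ : ℕ → Ω → ℝ}

theorem isExtremalLaw_map_arrivalLimit (hL : 0 < L)
    (hp : ∀ C, IsClosed C → ∫ y in C, lam y ∂vol = L * p.real C)
    (hx : ∀ i, Measurable (x i)) (hxlaw : ∀ i, P.map (x i) = p) (hxind : iIndepFun x P)
    (hξ : ∀ j, Measurable (ξ j)) (hlaw : ∀ j, P.map (ξ j) = expMeasure L)
    (hind : iIndepFun ξ P) (hxξ : IndepFun (fun ω i => x i ω) (fun ω j => ξ j ω) P)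
    (hpos : ∀ ω j, 0 ≤ ξ j ω)
    (hdiv : ∀ ω, Tendsto (fun n => ∑ j ∈ Finset.range n, ξ j ω) atTop atTop) :
    IsExtremalLaw vol lam
      (P.map fun ω => arrivalLimit (fun i => x i ω) (hpos ω) (hdiv ω)) := by
  have hW := measurable_arrivalLimit hx hξ hpos hdiv
  have := Measure.isProbabilityMeasure_map (μ := P) hW.aemeasurable
  refine IsExtremalLaw.of_measure_eq (fun C hC => by rw [hp C hC]; positivity)
    fun k C hC hdisj S t => ?_
  -- By disjointness `h` equals `max (t i) 0` on `C i`; truncation at 0 changes nothing since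
  -- arrival times are nonnegative. The integral of `h` is a sum over `i`, so the void probability
  -- is a product.
  let h : X → ℝ := fun y => ∑ i ∈ S, (C i).indicator (fun _ => max (t i) 0) y
  have hterm : ∀ i y, 0 ≤ (C i).indicator (fun _ => max (t i) 0) y := fun i y =>
    Set.indicator_nonneg (fun _ _ => le_max_right _ _) y
  have hm : Measurable h :=
    Finset.measurable_sum _ fun i _ => measurable_const.indicator (hC i).measurableSet
  have hh0 : ∀ y, 0 ≤ h y := fun y => Finset.sum_nonneg fun i _ => hterm i y
  have hhH : ∀ y, h y ≤ ∑ i ∈ S, max (t i) 0 := fun y => Finset.sum_le_sum fun i _ =>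
    Set.indicator_le_self' (fun _ _ => le_max_right _ _) y
  have hindint : ∀ i ∈ S, Integrable ((C i).indicator fun _ => max (t i) 0) p := fun i _ =>
    (integrable_const _).indicator (hC i).measurableSet
  have hint : Integrable h p := integrable_finsetSum S hindint
  have hset : {ω | ∀ i ∈ S, (t i : EReal) ≤
      (arrivalLimit (fun i => x i ω) (hpos ω) (hdiv ω)).infOn (C i)} =
      {ω | ∀ n, h (x n ω) ≤ ∑ j ∈ Finset.range (n + 1), ξ j ω} := by
    ext ω
    simp only [Set.mem_ofPred_eq, le_infOn_arrivalLimit_iff, EReal.coe_le_coe_iff]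
    constructor
    · intro hω n
      have hsum : 0 ≤ ∑ j ∈ Finset.range (n + 1), ξ j ω := Finset.sum_nonneg fun j _ => hpos ω j
      by_cases hex : ∃ i ∈ S, x n ω ∈ C i
      · obtain ⟨i, hi, hxi⟩ := hex
        have : h (x n ω) = max (t i) 0 := by
          rw [← Set.indicator_of_mem hxi (fun _ => max (t i) 0)]
          refine Finset.sum_eq_single_of_mem i hi fun j _ hji => ?_
          exact Set.indicator_of_notMem (fun hxj => Set.disjoint_left.1 (hdisj hji) hxj hxi) _
        rw [this]
        exact max_le (hω i hi n hxi) hsum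
      · refine le_of_eq_of_le (Finset.sum_eq_zero fun i hi => ?_) hsum
        exact Set.indicator_of_notMem (fun hxi => hex ⟨i, hi, hxi⟩) _
    · intro hω i hi n hxi
      refine (le_trans ?_ (Finset.single_le_sum (fun i _ => hterm i (x n ω)) hi)).trans (hω n)
      rw [Set.indicator_of_mem hxi]
      exact le_max_left _ _
  have hmeas : MeasurableSet {f : LscFun X | ∀ i ∈ S, (t i : EReal) ≤ f.infOn (C i)} := by
    simp only [Set.ofPred_forall]
    exact Finset.measurableSet_biInter S fun i _ => LscFun.measurableSet_le_infOn (hC i) (t i)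
  rw [Measure.map_apply hW hmeas, Set.preimage_ofPred_eq, hset,
    measure_forall_le_sum hL hm hint hhH hx hxlaw hxind hξ hlaw hind hxξ hdiv, voidProb,
    ← ENNReal.ofReal_prod_of_nonneg (fun _ _ => (Real.exp_pos _).le), ← Real.exp_sum,
    Finset.sum_neg_distrib]
  simp only [sub_zero, max_eq_left (hh0 _)]
  rw [integral_finsetSum S hindint, Finset.mul_sum]
  congr 3
  refine Finset.sum_congr rfl fun i _ => ?_
  rw [integral_indicator_const _ (hC i).measurableSet, hp _ (hC i), smul_eq_mul, mul_assoc]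

end LimitLaw

/-! ### Divergence of the arrival times -/

section Divergence

variable {Ω : Type*} [MeasurableSpace Ω] {P : Measure Ω} {ξ : ℕ → Ω → ℝ} {L : ℝ}

theorem ae_nonneg_of_hasLaw_expMeasure {Y : Ω → ℝ} (hL : 0 < L) (hY : HasLaw Y (expMeasure L) P) :
    ∀ᵐ ω ∂P, 0 ≤ Y ω := by
  have := isProbabilityMeasure_expMeasure hL
  refine ae_of_ae_map (p := fun u => 0 ≤ u) hY.aemeasurable ?_
  rw [hY.map_eq]
  change Set.Ici (0 : ℝ) ∈ ae (expMeasure L)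
  rw [mem_ae_iff_prob_eq_one measurableSet_Ici, expMeasure_Ici hL]
  simp

/-- The law of large numbers for the bounded variables 1_{ξ_j ≥ 1} ≤ ξ_j, of mean exp(-L) > 0, makes
the sums grow at least linearly. -/
theorem ae_tendsto_sum_expMeasure [IsProbabilityMeasure P] (hL : 0 < L)
    (hlaw : ∀ j, HasLaw (ξ j) (expMeasure L) P) (hind : iIndepFun ξ P) :
    ∀ᵐ ω ∂P, Tendsto (fun n => ∑ j ∈ Finset.range n, ξ j ω) atTop atTop := by
  let g : ℝ → ℝ := (Set.Ici (1 : ℝ)).indicator fun _ => 1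
  have hg : Measurable g := measurable_const.indicator measurableSet_Ici
  have hgξ : ∀ j, AEMeasurable (g ∘ ξ j) P := fun j =>
    hg.comp_aemeasurable (hlaw j).aemeasurable
  have hint : Integrable (g ∘ ξ 0) P := by
    refine Integrable.of_bound (hgξ 0).aestronglyMeasurable 1 (Eventually.of_forall fun ω => ?_)
    simp only [g, Function.comp_apply, Set.indicator]
    split_ifs <;> simp
  have hmean : P[g ∘ ξ 0] = Real.exp (-L) := by
    have h1 : P[g ∘ ξ 0] = ∫ u, g u ∂(expMeasure L) := by
      rw [← (hlaw 0).map_eq, integral_map (hlaw 0).aemeasurable hg.aestronglyMeasurable]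
      rfl
    rw [h1, integral_indicator_const _ measurableSet_Ici, measureReal_def, expMeasure_Ici hL,
      ENNReal.toReal_ofReal (Real.exp_pos _).le]
    simp
  have hslln := strong_law_ae_real (fun j => g ∘ ξ j) hint
    (fun i j hij => (hind.indepFun hij).comp hg hg)
    (fun i => (IdentDistrib.mk (hlaw i).aemeasurable (hlaw 0).aemeasurable
      ((hlaw i).map_eq.trans (hlaw 0).map_eq.symm)).comp hg)
  have hpos := ae_all_iff.2 fun j => ae_nonneg_of_hasLaw_expMeasure hL (hlaw j)
  filter_upwards [hslln, hpos] with ω hω hω0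
  rw [hmean] at hω
  have h2 := hω.pos_mul_atTop (Real.exp_pos _) (tendsto_natCast_atTop_atTop (R := ℝ))
  refine tendsto_atTop_mono' _ ?_ h2
  filter_upwards [eventually_gt_atTop 0] with n hn
  rw [div_mul_cancel₀ _ (by positivity)]
  refine Finset.sum_le_sum fun j _ => ?_
  change (Set.Ici (1 : ℝ)).indicator (fun _ => 1) (ξ j ω) ≤ ξ j ω
  exact Set.indicator_apply_le' (fun h => h) fun _ => hω0 j

/-- `arrivalLimit` takes nonnegativity and divergence as arguments, so they must hold at every `ω`.
-/
theorem exists_modification_expMeasure [IsProbabilityMeasure P] (hL : 0 < L)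
    (hlaw : ∀ j, HasLaw (ξ j) (expMeasure L) P) (hind : iIndepFun ξ P) :
    ∃ ξ' : ℕ → Ω → ℝ, (∀ j, Measurable (ξ' j)) ∧ (∀ j, ξ j =ᵐ[P] ξ' j) ∧ (∀ ω j, 0 ≤ ξ' j ω) ∧
      ∀ ω, Tendsto (fun n => ∑ j ∈ Finset.range n, ξ' j ω) atTop atTop := by
  classical
  let η : ℕ → Ω → ℝ := fun j => (hlaw j).aemeasurable.mk
  have hη : ∀ j, ξ j =ᵐ[P] η j := fun j => (hlaw j).aemeasurable.ae_eq_mk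
  have hgood : ∀ᵐ ω ∂P, (∀ j, 0 ≤ η j ω) ∧
      Tendsto (fun n => ∑ j ∈ Finset.range n, η j ω) atTop atTop := by
    filter_upwards [ae_all_iff.2 hη, ae_tendsto_sum_expMeasure hL hlaw hind,
      ae_all_iff.2 fun j => ae_nonneg_of_hasLaw_expMeasure hL (hlaw j)] with ω h1 h2 h3
    simp only [h1] at h2 h3
    exact ⟨h3, h2⟩
  obtain ⟨G, hGae, hG, hGgood⟩ := hgood.exists_measurable_mem
  -- Off the good set, the constant 1 keeps the terms nonnegative and the sums divergent.
  refine ⟨fun j => G.piecewise (η j) fun _ => 1,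
    fun j => Measurable.piecewise hG (hlaw j).aemeasurable.measurable_mk measurable_const,
    fun j => ?_, fun ω j => ?_, fun ω => ?_⟩
  · filter_upwards [hη j, hGae] with ω h1 h2
    rw [Set.piecewise_eq_of_mem _ _ _ h2, h1]
  · by_cases hω : ω ∈ G
    · simpa [hω] using (hGgood ω hω).1 j
    · simp [hω]
  · by_cases hω : ω ∈ G
    · simpa [hω] using (hGgood ω hω).2
    · simpa [hω] using tendsto_natCast_atTop_atTop (R := ℝ)

end Divergence

/-! ### Assembly -/

theorem setIntegral_eq_mul_withDensity {X : Type*} [MeasurableSpace X] {vol : Measure X}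
    {lam : X → ℝ} (hm : Measurable lam) (hlam : ∀ y, 0 ≤ lam y) {L : ℝ} (hL : 0 < L) {C : Set X}
    (hC : MeasurableSet C) :
    ∫ y in C, lam y ∂vol =
      L * (vol.withDensity fun y => ENNReal.ofReal (lam y / L)).real C := by
  rw [measureReal_def, withDensity_apply _ hC, ← integral_eq_lintegral_of_nonneg_ae
    (Eventually.of_forall fun y => div_nonneg (hlam y) hL.le)
    (hm.div_const L).aestronglyMeasurable, integral_div, mul_div_cancel₀ _ hL.ne']

theorem mainTheorem8 {d : ℕ} (D : Set (EuclideanSpace ℝ (Fin d)))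
    (hD_open : IsOpen D) (hD_conn : IsConnected D) (hD_bdd : Bornology.IsBounded D)
    (lam : closure D → ℝ) (hlam_cont : Continuous lam) (hlam_pos : ∀ y, 0 < lam y)
    (lamBar : ℝ) (hlamBar : lamBar = ∫ y, lam y ∂(closureVolume D))
    {Ω : Type*} [MeasurableSpace Ω] (P : Measure Ω) [IsProbabilityMeasure P]
    (x : ℕ → Ω → closure D) (ξ : ℕ → Ω → ℝ)
    (hx_law : ∀ i, HasLaw (x i)
      ((closureVolume D).withDensity fun y => ENNReal.ofReal (lam y / lamBar)) P)
    (hx_indep : iIndepFun x P)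
    (hξ_law : ∀ j, HasLaw (ξ j) (expMeasure lamBar) P)
    (hξ_indep : iIndepFun ξ P)
    (hxξ : IndepFun (fun ω i => x i ω) (fun ω j => ξ j ω) P) :
    ∃ ν : ProbabilityMeasure (LscFun (closure D)),
      IsExtremalLaw (closureVolume D) lam (ν : Measure (LscFun (closure D))) ∧
      (∀ ν' : ProbabilityMeasure (LscFun (closure D)),
        IsExtremalLaw (closureVolume D) lam (ν' : Measure (LscFun (closure D))) → ν' = ν) ∧
      TendstoInDistribution
        (fun n ω => arrivalLsc (fun i => x i ω) (fun j => ξ j ω) n) atTop id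
        (fun _ => P) (ν : Measure (LscFun (closure D))) := by
  have : CompactSpace (closure D) := isCompact_iff_compactSpace.1 hD_bdd.isCompact_closure
  set p := (closureVolume D).withDensity fun y => ENNReal.ofReal (lam y / lamBar) with hp
  have hprob : IsProbabilityMeasure p := by
    rw [← (hx_law 0).map_eq]
    exact Measure.isProbabilityMeasure_map (hx_law 0).aemeasurable
  have hL : 0 < lamBar := by
    -- If `lamBar` were 0, then `lam y / lamBar = 0` by the convention for division by zero, so `p`
    -- would vanish, although it is the law of `x 0`.
    refine lt_of_le_of_ne (hlamBar ▸ integral_nonneg fun y => (hlam_pos y).le) fun h0 => ?_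
    refine IsProbabilityMeasure.ne_zero p ?_
    simp [hp, ← h0]
  have hpC : ∀ C : Set (closure D), IsClosed C →
      ∫ y in C, lam y ∂(closureVolume D) = lamBar * p.real C := fun C hC =>
    setIntegral_eq_mul_withDensity hlam_cont.measurable (fun y => (hlam_pos y).le) hL
      hC.measurableSet
  obtain ⟨ξ', hξ'm, hξ'eq, hpos, hdiv⟩ := exists_modification_expMeasure hL hξ_law hξ_indep
  let x' : ℕ → Ω → closure D := fun i => (hx_law i).aemeasurable.mk
  have hx'm : ∀ i, Measurable (x' i) := fun i => (hx_law i).aemeasurable.measurable_mk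
  have hx'eq : ∀ i, x i =ᵐ[P] x' i := fun i => (hx_law i).aemeasurable.ae_eq_mk
  have hxω : (fun ω i => x i ω) =ᵐ[P] fun ω i => x' i ω := by
    filter_upwards [ae_all_iff.2 hx'eq] with ω hω using funext hω
  have hξω : (fun ω j => ξ j ω) =ᵐ[P] fun ω j => ξ' j ω := by
    filter_upwards [ae_all_iff.2 hξ'eq] with ω hω using funext hω
  have hW := measurable_arrivalLimit hx'm hξ'm hpos hdiv
  let ν : ProbabilityMeasure (LscFun (closure D)) :=
    ⟨P.map fun ω => arrivalLimit (fun i => x' i ω) (hpos ω) (hdiv ω),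
      Measure.isProbabilityMeasure_map hW.aemeasurable⟩
  have hν : IsExtremalLaw (closureVolume D) lam (ν : Measure (LscFun (closure D))) :=
    isExtremalLaw_map_arrivalLimit hL hpC hx'm
      (fun i => (Measure.map_congr (hx'eq i)).symm.trans (hx_law i).map_eq)
      (hx_indep.congr hx'eq) hξ'm
      (fun j => (Measure.map_congr (hξ'eq j)).symm.trans (hξ_law j).map_eq)
      (hξ_indep.congr hξ'eq) (hxξ.congr hxω hξω) hpos hdiv
  refine ⟨ν, hν, fun ν' hν' => ?_, ?_⟩
  · have h : (ν' : Measure (LscFun (closure D))) = ν := IsExtremalLaw.eq hν' hν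
    exact Subtype.ext h
  have hlim : TendstoInDistribution
      (fun n ω => arrivalLsc (fun i => x' i ω) (fun j => ξ' j ω) n) atTop
      (fun ω => arrivalLimit (fun i => x' i ω) (hpos ω) (hdiv ω)) (fun _ => P) P :=
    tendstoInDistribution_of_ae_tendsto
      (fun n => (measurable_arrivalLsc hx'm hξ'm n).aemeasurable) hW.aemeasurable
      (Eventually.of_forall fun ω => tendsto_arrivalLsc (hpos ω) (hdiv ω))
  -- Weak convergence depends only on the law of the limit, so the limit may be realized as `id`
  -- under `ν`.
  have hmap : (ν : Measure (LscFun (closure D))).map id =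
      P.map fun ω => arrivalLimit (fun i => x' i ω) (hpos ω) (hdiv ω) := Measure.map_id
  have hlim' : TendstoInDistribution
      (fun n ω => arrivalLsc (fun i => x' i ω) (fun j => ξ' j ω) n) atTop id
      (fun _ => P) (ν : Measure (LscFun (closure D))) := by
    refine ⟨hlim.forall_aemeasurable, aemeasurable_id, ?_⟩
    have heq : (⟨P.map fun ω => arrivalLimit (fun i => x' i ω) (hpos ω) (hdiv ω),
        Measure.isProbabilityMeasure_map hW.aemeasurable⟩ :
          ProbabilityMeasure (LscFun (closure D))) =
        ⟨(ν : Measure (LscFun (closure D))).map id,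
          Measure.isProbabilityMeasure_map aemeasurable_id⟩ := Subtype.ext hmap.symm
    exact heq ▸ hlim.tendsto
  refine hlim'.congr (fun n => ?_) EventuallyEq.rfl
  filter_upwards [hxω, hξω] with ω h1 h2
  rw [← h1, ← h2]
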